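/- **Proposition 3.** Consider the open online dial-a-ride problem on the real line: a server of capacity $c\in\{1,2,\dots\}\cup\{\infty\}$ starts in the origin $0$ at time $0$ and moves with speed at most $1$. For a request sequence $\sigma=(r_1,\dots,r_n)$, $n\ge 1$, with $r_i=(a_i,b_i;t_i)$, $a_i,b_i\in\mathbb{R}$ and $0<t_1<\dots<t_n$, request $r_i$ becomes known at time $t_i$; it is served by loading it at $a_i$ no earlier than $t_i$ and transporting it to $b_i$, where alone it may be unloaded (non-preemption). At most $c$ requests may be on board simultaneously, and the server need not return to the origin. Let $\mathrm{Opt}(t)$ be the least completion time of an offline schedule serving all requests released no later than $t$ (with $\mathrm{Opt}(t)=0$ if there are none), and let $\mathrm{Opt}(\sigma)=\mathrm{Opt}(t_n)$. For a set $R$ of released requests and $x\in\mathbb{R}$, let $S(R,x)$ be a shortest schedule that starts in $x$ and serves all requests in $R$. For $\alpha\ge 0$, the algorithm $\textsc{Lazy}(\alpha)$ is as follows. Whenever a request arrives, at time $t$, and the server can deliver all requests on board and return to the origin by time $\alpha\cdot\mathrm{Opt}(t)$, it aborts what it is doing and does so in a shortest way; otherwise it continues what it is doing. Whenever the server is idle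 (it has completed a command, or it has nothing to do and a request arrives that does not make it return to the origin), at time $t$: if $t<\alpha\cdot\mathrm{Opt}(t)$, it waits at its position until time $\alpha\cdot\mathrm{Opt}(t)$; otherwise, if the set $R_t$ of released and unserved requests is nonempty, it follows $S(R_t,p_t)$, where $p_t$ is its position; otherwise it rests. A request arriving at the very moment at which a command is completed is handled first. Let $\mathrm{Alg}(\sigma)$ be the time at which $\textsc{Lazy}(\alpha)$ has served all requests of $\sigma$. Then, for every $\alpha\in[0,1)$, every capacity $c\in\{1,2,\dots\}\cup\{\infty\}$, and every choice among shortest schedules in the algorithm, the competitive ratio of $\textsc{Lazy}(\alpha)$ satisfies $$\sup_{\sigma}\frac{\mathrm{Alg}(\sigma)}{\mathrm{Opt}(\sigma)}\;\ge\;2+\alpha+\frac{1-\alpha}{2+3\alpha}.$$ -/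

import Mathlib

open scoped ENNReal

noncomputable section

namespace DialARide

/-- A sequence `r₁, …, rₙ` of requests `rᵢ = (src i, dst i; release i)` on the real line, with
release times `0 < release r₁ < ⋯ < release rₙ` (indexed by `Fin n`, i.e. from `0`). -/
structure RequestSeq where
  n : ℕ
  src : Fin n → ℝ
  dst : Fin n → ℝ
  release : Fin n → ℝ
  release_pos : ∀ i, 0 < release i
  release_strictMono : StrictMono release

/-- The data of a schedule: the position of the server, the times at which requests are collected
and unloaded (meaningful only for the requests that the schedule deals with), and the time at which
the schedule ends.  All times are relative to the start of the schedule. -/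
structure Schedule (n : ℕ) where
  pos : ℝ → ℝ
  load : Fin n → ℝ
  unload : Fin n → ℝ
  finish : ℝ

/-- The server starts in `x`, moves with speed at most `1`, and the schedule has nonnegative
length. -/
structure Schedule.IsMotion {n : ℕ} (S : Schedule n) (x : ℝ) : Prop where
  start : S.pos 0 = x
  speed : ∀ s t, 0 ≤ s → s ≤ t → |S.pos t - S.pos s| ≤ t - s
  finish_nonneg : 0 ≤ S.finish

/-- `S` is a non-preemptive schedule that starts in `x` with an empty server of capacity `c` and
serves all requests in `R`, the request `i` being available for collection from time `rel i` on.

`capacity` bounds the number of requests on board at any time.  A request that is collected and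
unloaded at the same instant is not seen by it; `room` says that it, too, needs a free slot, besides
the requests that are carried through this instant. -/
structure Schedule.Serves (c : ℕ∞) (σ : RequestSeq) (rel : Fin σ.n → ℝ) (R : Finset (Fin σ.n))
    (x : ℝ) (S : Schedule σ.n) : Prop extends S.IsMotion x where
  load_nonneg : ∀ i ∈ R, 0 ≤ S.load i
  rel_le_load : ∀ i ∈ R, rel i ≤ S.load i
  load_le_unload : ∀ i ∈ R, S.load i ≤ S.unload i
  unload_le_finish : ∀ i ∈ R, S.unload i ≤ S.finish
  pos_load : ∀ i ∈ R, S.pos (S.load i) = σ.src i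
  pos_unload : ∀ i ∈ R, S.pos (S.unload i) = σ.dst i
  capacity : ∀ t, ((R.filter fun j => S.load j ≤ t ∧ t < S.unload j).card : ℕ∞) ≤ c
  room : ∀ i ∈ R,
    ((R.filter fun j => S.load j < S.load i ∧ S.load i < S.unload j).card : ℕ∞) < c

/-- Starting in `x` with exactly the requests in `L` on board, `S` delivers all of them, collects
nothing, and ends in the origin. -/
structure Schedule.Delivers (σ : RequestSeq) (L : Finset (Fin σ.n)) (x : ℝ)
    (S : Schedule σ.n) : Prop extends S.IsMotion x where
  unload_nonneg : ∀ i ∈ L, 0 ≤ S.unload i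
  unload_le_finish : ∀ i ∈ L, S.unload i ≤ S.finish
  pos_unload : ∀ i ∈ L, S.pos (S.unload i) = σ.dst i
  pos_finish : S.pos S.finish = 0

/-- `S` is a shortest schedule with the property `P`. -/
def Schedule.IsShortest {n : ℕ} (P : Schedule n → Prop) (S : Schedule n) : Prop :=
  P S ∧ ∀ S', P S' → S.finish ≤ S'.finish

/-- The offline optimum for the requests in `R`: the least completion time of a schedule that starts
in the origin at time `0`, serves all of `R`, and collects no request before its release. -/
def optOf (c : ℕ∞) (σ : RequestSeq) (R : Finset (Fin σ.n)) : ℝ :=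
  sInf {T | ∃ S : Schedule σ.n, S.Serves c σ σ.release R 0 ∧ S.finish = T}

/-- `Opt(t)`: the offline optimum over all requests released not later than `t`. -/
def opt (c : ℕ∞) (σ : RequestSeq) (t : ℝ) : ℝ :=
  optOf c σ (Finset.univ.filter fun i => σ.release i ≤ t)

/-- A way of choosing among shortest schedules.  `sched σ R x` is the schedule `S(R, x)`, a shortest
schedule from `x` that serves `R` (all of whose requests are released already), and `back σ L x` is
an optimal way to deliver the loaded requests `L` from `x` and to return to the origin. -/
structure TieBreaking (c : ℕ∞) where
  sched : (σ : RequestSeq) → Finset (Fin σ.n) → ℝ → Schedule σ.n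
  back : (σ : RequestSeq) → Finset (Fin σ.n) → ℝ → Schedule σ.n
  sched_shortest : ∀ σ R x,
    Schedule.IsShortest (Schedule.Serves c σ (fun _ => 0) R x) (sched σ R x)
  back_shortest : ∀ σ L x, Schedule.IsShortest (Schedule.Delivers σ L x) (back σ L x)

/-- What the server is doing.  `rest` means that it is idle and has nothing to do. -/
inductive Command (n : ℕ) where
  | rest
  | waitUntil (t' : ℝ)
  | deliverAndReturn (S : Schedule n)
  | followSchedule (R : Finset (Fin n)) (S : Schedule n)

/-- The state of the online algorithm: the number of requests that have arrived so far, the command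
being executed, and the time at which it was issued together with the position, the loaded requests
and the served requests at that time. -/
structure State (n : ℕ) where
  arrived : ℕ
  cmd : Command n
  start : ℝ
  pos : ℝ
  loaded : Finset (Fin n)
  served : Finset (Fin n)

namespace State

variable {n : ℕ}

/-- Position of the server at time `t` (from the start of the current command on, as long as the
command is not aborted). -/
def posAt (q : State n) (t : ℝ) : ℝ :=
  match q.cmd with
  | .rest => q.pos
  | .waitUntil _ => q.pos
  | .deliverAndReturn S => S.pos (t - q.start)
  | .followSchedule _ S => S.pos (t - q.start)

/-- The requests on board at time `t`. -/
def loadedAt (q : State n) (t : ℝ) : Finset (Fin n) :=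
  match q.cmd with
  | .rest => q.loaded
  | .waitUntil _ => q.loaded
  | .deliverAndReturn S => q.loaded.filter fun i => t < q.start + S.unload i
  | .followSchedule R S =>
      R.filter fun i => q.start + S.load i ≤ t ∧ t < q.start + S.unload i

/-- The requests that have been served by time `t`. -/
def servedAt (q : State n) (t : ℝ) : Finset (Fin n) :=
  match q.cmd with
  | .rest => q.served
  | .waitUntil _ => q.served
  | .deliverAndReturn S => q.served ∪ q.loaded.filter fun i => q.start + S.unload i ≤ t
  | .followSchedule R S => q.served ∪ R.filter fun i => q.start + S.unload i ≤ t

/-- The time at which the current command is completed, i.e. at which the server becomes idle. -/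
def endTime (q : State n) : WithTop ℝ :=
  match q.cmd with
  | .rest => ⊤
  | .waitUntil t' => (t' : ℝ)
  | .deliverAndReturn S => (q.start + S.finish : ℝ)
  | .followSchedule _ S => (q.start + S.finish : ℝ)

/-- Abort the current command at time `t` and execute `cmd` instead. -/
def execute (q : State n) (t : ℝ) (cmd : Command n) : State n where
  arrived := q.arrived
  cmd := cmd
  start := t
  pos := q.posAt t
  loaded := q.loadedAt t
  served := q.servedAt t

/-- The unserved ones among the requests that have arrived. -/
def unservedAt (q : State n) (t : ℝ) : Finset (Fin n) :=
  (Finset.univ.filter fun i : Fin n => (i : ℕ) < q.arrived) \ q.servedAt t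

end State

/-- The part of `Lazy(α)` that is invoked when the server is idle at time `t`. -/
def uponIdle {c : ℕ∞} (τ : TieBreaking c) (α : ℝ) (σ : RequestSeq) (t : ℝ) (q : State σ.n) :
    State σ.n :=
  if t < α * opt c σ t then
    q.execute t (.waitUntil (α * opt c σ t))
  else if q.unservedAt t ≠ ∅ then
    q.execute t (.followSchedule (q.unservedAt t) (τ.sched σ (q.unservedAt t) (q.posAt t)))
  else
    q.execute t .rest

/-- The part of `Lazy(α)` that is invoked when the next request arrives, at time `t`.  If the server
is at rest and is not sent back to the origin, it remains idle and the other part of the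
algorithm is invoked. -/
def uponRequest {c : ℕ∞} (τ : TieBreaking c) (α : ℝ) (σ : RequestSeq) (t : ℝ) (q : State σ.n) :
    State σ.n :=
  let q' : State σ.n := { q with arrived := q.arrived + 1 }
  if t + (τ.back σ (q.loadedAt t) (q.posAt t)).finish ≤ α * opt c σ t then
    q'.execute t (.deliverAndReturn (τ.back σ (q.loadedAt t) (q.posAt t)))
  else
    match q.cmd with
    | .rest => uponIdle τ α σ t q'
    | _ => q'

/-- Process the next event: the arrival of the next request or the completion of the current
command, whichever is earlier (the arrival, if both happen at the same time).  When no event is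
left, the state does not change any more. -/
def step {c : ℕ∞} (τ : TieBreaking c) (α : ℝ) (σ : RequestSeq) (q : State σ.n) : State σ.n :=
  open Classical in
  if h : ∃ h : q.arrived < σ.n, (σ.release ⟨q.arrived, h⟩ : WithTop ℝ) ≤ q.endTime then
    uponRequest τ α σ (σ.release ⟨q.arrived, h.choose⟩) q
  else
    if h' : q.endTime = ⊤ then q else uponIdle τ α σ (q.endTime.untop h') q

/-- At time `0` the server is idle in the origin, and no request has arrived. -/
def initState (n : ℕ) : State n where
  arrived := 0
  cmd := .rest
  start := 0
  pos := 0
  loaded := ∅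
  served := ∅

/-- The state of `Lazy(α)` after `k` events. -/
def run {c : ℕ∞} (τ : TieBreaking c) (α : ℝ) (σ : RequestSeq) (k : ℕ) : State σ.n :=
  (step τ α σ)^[k] (initState σ.n)

/-- All requests have arrived and have been served by time `T` in the run of `Lazy(α)`.  (After the
last arrival no command is aborted any more.) -/
def CompletedBy {c : ℕ∞} (τ : TieBreaking c) (α : ℝ) (σ : RequestSeq) (T : ℝ) : Prop :=
  ∃ k, (run τ α σ k).arrived = σ.n ∧ (run τ α σ k).start ≤ T ∧
    (run τ α σ k).servedAt T = Finset.univ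

/-- The completion time of `Lazy(α)` on `σ` (infinite if `σ` is never completed). -/
def lazyCost {c : ℕ∞} (τ : TieBreaking c) (α : ℝ) (σ : RequestSeq) : ℝ≥0∞ :=
  ⨅ (T : ℝ) (_ : CompletedBy τ α σ T), ENNReal.ofReal T

/-- The strict competitive ratio `sup_σ Alg(σ) / Opt(σ)` of `Lazy(α)` for server capacity `c` on the
line, over all nonempty request sequences. -/
def competitiveRatio {c : ℕ∞} (τ : TieBreaking c) (α : ℝ) : ℝ≥0∞ :=
  ⨆ (σ : RequestSeq) (_ : 0 < σ.n),
    lazyCost τ α σ / ENNReal.ofReal (optOf c σ Finset.univ)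

/-- A path of speed at most `1` that visits bounded prescribed points at well separated times. -/
theorem exists_path (D : ℝ) (hD : 0 < D) (p : ℕ → ℝ) (hp : ∀ k m, |p k - p m| ≤ D) :
    ∃ g : ℝ → ℝ, (∀ s t, s ≤ t → |g t - g s| ≤ t - s) ∧ ∀ k : ℕ, g (k * D) = p k := by
  have key : ∀ k : ℕ, p ⌊(k * D) / D⌋₊ = p k := by
    intro k
    rw [mul_div_cancel_right₀ _ hD.ne', Nat.floor_natCast]
  have hL : LipschitzOnWith 1 (fun t => p ⌊t / D⌋₊) (Set.range fun k : ℕ => (k : ℝ) * D) := by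
    refine LipschitzOnWith.of_dist_le_mul ?_
    rintro _ ⟨k, rfl⟩ _ ⟨m, rfl⟩
    simp only [key, Real.dist_eq, NNReal.coe_one, one_mul]
    rcases eq_or_ne k m with rfl | hkm
    · simp
    · rw [← sub_mul, abs_mul, abs_of_pos hD]
      have : (1 : ℝ) ≤ |(k : ℝ) - m| := by
        have : (1 : ℤ) ≤ |(k : ℤ) - m| := Int.one_le_abs (by omega)
        exact_mod_cast this
      nlinarith [hp k m]
  obtain ⟨g, hg, hge⟩ := hL.extend_real
  refine ⟨g, fun s t hst => ?_, fun k => ?_⟩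
  · have := hg.dist_le_mul t s
    simpa [Real.dist_eq, abs_of_nonneg (sub_nonneg.2 hst)] using this
  · rw [← hge ⟨k, rfl⟩]; exact key k

/-- A shortest schedule exists if the schedules in question can be normalised to a closed set of
bounded data (for the product topology). -/
theorem exists_shortest_of_closed {n : ℕ} (P : Schedule n → Prop) (x : ℝ)
    (C : Set ((ℝ → ℝ) × (Fin n → ℝ) × (Fin n → ℝ) × ℝ)) (hC : IsClosed C)
    (hC1 : ∀ z ∈ C, (∀ t, |z.1 t - x| ≤ |t|) ∧ (∀ i, 0 ≤ z.2.1 i ∧ z.2.1 i ≤ z.2.2.2) ∧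
      (∀ i, 0 ≤ z.2.2.1 i ∧ z.2.2.1 i ≤ z.2.2.2) ∧ 0 ≤ z.2.2.2)
    (hCP : ∀ z ∈ C, P ⟨z.1, z.2.1, z.2.2.1, z.2.2.2⟩)
    (hPC : ∀ S, P S → ∃ z ∈ C, z.2.2.2 = S.finish)
    (hne : ∃ S, P S) : ∃ S, Schedule.IsShortest P S := by
  obtain ⟨S₀, hS₀⟩ := hne
  obtain ⟨z₀, hz₀, hf₀⟩ := hPC S₀ hS₀
  set f₀ := S₀.finish
  let B : Set ((ℝ → ℝ) × (Fin n → ℝ) × (Fin n → ℝ) × ℝ) :=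
    (Set.univ.pi fun t => Set.Icc (x - |t|) (x + |t|)) ×ˢ (Set.univ.pi fun _ => Set.Icc 0 f₀) ×ˢ
      (Set.univ.pi fun _ => Set.Icc 0 f₀) ×ˢ Set.Icc 0 f₀
  have hB : IsCompact B :=
    (isCompact_univ_pi fun _ => isCompact_Icc).prod
      ((isCompact_univ_pi fun _ => isCompact_Icc).prod
        ((isCompact_univ_pi fun _ => isCompact_Icc).prod isCompact_Icc))
  have hmem : ∀ z ∈ C, z.2.2.2 ≤ f₀ → z ∈ B := by
    intro z hz hzf
    obtain ⟨h1, h2, h3, h4⟩ := hC1 z hz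
    refine ⟨fun t _ => ?_, fun i _ => ⟨(h2 i).1, (h2 i).2.trans hzf⟩,
      fun i _ => ⟨(h3 i).1, (h3 i).2.trans hzf⟩, h4, hzf⟩
    have := abs_le.1 (h1 t)
    constructor <;> linarith
  obtain ⟨z, hz, hmin⟩ := (hB.inter_left hC).exists_isMinOn ⟨z₀, hz₀, hmem z₀ hz₀ hf₀.le⟩
    (f := fun z => z.2.2.2) (by fun_prop)
  refine ⟨_, hCP z hz.1, fun S' hS' => ?_⟩
  obtain ⟨z', hz', hf'⟩ := hPC S' hS'
  rw [← hf']
  rcases le_or_gt z'.2.2.2 f₀ with h | h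
  · exact hmin ⟨hz', hmem z' hz' h⟩
  · exact (hz.2.2.2.2.2).trans h.le

theorem exists_back (σ : RequestSeq) (L : Finset (Fin σ.n)) (x : ℝ) :
    ∃ S, Schedule.IsShortest (Schedule.Delivers σ L x) S := by
  refine exists_shortest_of_closed _ x
    {z | (∀ t, |z.1 t - x| ≤ |t|) ∧ (∀ i, 0 ≤ z.2.1 i ∧ z.2.1 i ≤ z.2.2.2) ∧
      (∀ i, 0 ≤ z.2.2.1 i ∧ z.2.2.1 i ≤ z.2.2.2) ∧ 0 ≤ z.2.2.2 ∧
      (∀ s t, |z.1 t - z.1 s| ≤ |t - s|) ∧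
      (∀ i ∈ L, ∀ s, |z.1 s - σ.dst i| ≤ |s - z.2.2.1 i|) ∧
      (∀ s, |z.1 s - 0| ≤ |s - z.2.2.2|)} ?_ ?_ ?_ ?_ ?_
  · simp only [Set.ofPred_and, Set.ofPred_forall]
    repeat' first
      | apply IsClosed.inter
      | (apply isClosed_iInter; intro)
      | (apply isClosed_le <;> fun_prop)
  · exact fun z hz => ⟨hz.1, hz.2.1, hz.2.2.1, hz.2.2.2.1⟩
  · rintro z ⟨h1, h2, h3, h4, h5, h6, h7⟩
    refine ⟨⟨?_, ?_, h4⟩, fun i _ => (h3 i).1, fun i _ => (h3 i).2, ?_, ?_⟩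
    · have := h1 0; simpa [sub_eq_zero] using this
    · intro s t _ hst
      have := h5 s t; rwa [abs_of_nonneg (sub_nonneg.2 hst)] at this
    · intro i hi
      have := h6 i hi (z.2.2.1 i); simpa [sub_eq_zero] using this
    · have := h7 z.2.2.2; simpa [sub_eq_zero] using this
  · intro S hS
    have hsp : ∀ s t, 0 ≤ s → 0 ≤ t → |S.pos t - S.pos s| ≤ |t - s| := by
      intro s t hs ht
      rcases le_total s t with h | h
      · rw [abs_of_nonneg (sub_nonneg.2 h)]; exact hS.speed s t hs h
      · rw [abs_sub_comm, abs_sub_comm t, abs_of_nonneg (sub_nonneg.2 h)]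
        exact hS.speed t s ht h
    have hmx : ∀ s t : ℝ, |max t 0 - max s 0| ≤ |t - s| := fun s t => by
      simpa using abs_max_sub_max_le_max t 0 s 0
    classical
    refine ⟨⟨fun t => S.pos (max t 0), fun _ => 0, fun i => if i ∈ L then S.unload i else 0,
      S.finish⟩, ⟨?_, ?_, ?_, hS.finish_nonneg, ?_, ?_, ?_⟩, rfl⟩
    · intro t
      have := hsp 0 (max t 0) le_rfl (le_max_right _ _)
      rw [hS.start] at this
      exact this.trans (by simpa using hmx 0 t)
    · exact fun i => ⟨le_rfl, hS.finish_nonneg⟩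
    · intro i
      dsimp only
      split_ifs with hi
      · exact ⟨hS.unload_nonneg i hi, hS.unload_le_finish i hi⟩
      · exact ⟨le_rfl, hS.finish_nonneg⟩
    · exact fun s t => (hsp _ _ (le_max_right _ _) (le_max_right _ _)).trans (hmx s t)
    · intro i hi s
      have h0 := hS.unload_nonneg i hi
      simp only [if_pos hi]
      rw [← hS.pos_unload i hi]
      refine (hsp _ _ h0 (le_max_right _ _)).trans ?_
      simpa [max_eq_left h0] using hmx (S.unload i) s
    · intro s
      have h0 := hS.finish_nonneg
      have hf := hS.pos_finish
      change |S.pos (max s 0) - 0| ≤ |s - S.finish|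
      nth_rewrite 2 [← hf]
      refine (hsp _ _ h0 (le_max_right _ _)).trans ?_
      simpa [max_eq_left h0] using hmx S.finish s
  · set A := |x| + ∑ i, |σ.dst i| with hA
    have hdst : ∀ i, |σ.dst i| ≤ A := fun i =>
      (Finset.single_le_sum (f := fun i => |σ.dst i|) (fun _ _ => abs_nonneg _)
        (Finset.mem_univ i)).trans (le_add_of_nonneg_left (abs_nonneg x))
    have hx : |x| ≤ A := le_add_of_nonneg_right (Finset.sum_nonneg fun _ _ => abs_nonneg _)
    have hA0 : 0 ≤ A := (abs_nonneg x).trans hx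
    let p : ℕ → ℝ := fun k => if k = 0 then x else if h : k - 1 < σ.n then σ.dst ⟨k - 1, h⟩ else 0
    have hp : ∀ k, |p k| ≤ A := by
      intro k
      simp only [p]
      split_ifs
      · exact hx
      · exact hdst _
      · simpa using hA0
    obtain ⟨g, hg, hgp⟩ := exists_path (2 * A + 1) (by linarith) p (fun k m => by
      have := abs_sub (p k) (p m); linarith [hp k, hp m])
    have hD : 0 < 2 * A + 1 := by linarith
    refine ⟨⟨g, fun _ => 0, fun i => ((i : ℕ) + 1 : ℕ) * (2 * A + 1),
      (σ.n + 1 : ℕ) * (2 * A + 1)⟩, ⟨?_, fun s t _ h => hg s t h, by positivity⟩,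
      fun i _ => by positivity, fun i _ => ?_, fun i _ => ?_, ?_⟩
    · simpa [p] using hgp 0
    · dsimp only
      have := i.2
      exact mul_le_mul_of_nonneg_right (Nat.cast_le.2 (by omega)) hD.le
    · exact (hgp _).trans (by simp [p])
    · exact (hgp _).trans (by simp [p])

theorem exists_sched (c : ℕ∞) (hc : 1 ≤ c) (σ : RequestSeq) (R : Finset (Fin σ.n)) (x : ℝ) :
    ∃ S, Schedule.IsShortest (Schedule.Serves c σ (fun _ => 0) R x) S := by
  classical
  refine exists_shortest_of_closed _ x
    {z | (∀ t, |z.1 t - x| ≤ |t|) ∧ (∀ i, 0 ≤ z.2.1 i ∧ z.2.1 i ≤ z.2.2.2) ∧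
      (∀ i, 0 ≤ z.2.2.1 i ∧ z.2.2.1 i ≤ z.2.2.2) ∧ 0 ≤ z.2.2.2 ∧
      (∀ s t, |z.1 t - z.1 s| ≤ |t - s|) ∧
      (∀ i ∈ R, ∀ s, |z.1 s - σ.src i| ≤ |s - z.2.1 i|) ∧
      (∀ i ∈ R, ∀ s, |z.1 s - σ.dst i| ≤ |s - z.2.2.1 i|) ∧
      (∀ i ∈ R, z.2.1 i ≤ z.2.2.1 i) ∧
      (∀ J : Finset (Fin σ.n), J ⊆ R → c < (J.card : ℕ∞) →
        z ∈ ⋃ i ∈ J, ⋃ j ∈ J, {z | z.2.2.1 j ≤ z.2.1 i}) ∧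
      (∀ i ∈ R, ∀ J : Finset (Fin σ.n), J ⊆ R → c ≤ (J.card : ℕ∞) →
        z ∈ ⋃ j ∈ J, ({z | z.2.1 i ≤ z.2.1 j} ∪ {z | z.2.2.1 j ≤ z.2.1 i}))} ?_ ?_ ?_ ?_ ?_
  · simp only [Set.ofPred_and, Set.ofPred_forall, Set.ofPred_mem_eq]
    repeat' first
      | apply IsClosed.inter
      | apply IsClosed.union
      | (apply isClosed_iInter; intro)
      | (apply isClosed_le <;> fun_prop)
      | (apply isClosed_biUnion_finset; intros)
  · exact fun z hz => ⟨hz.1, hz.2.1, hz.2.2.1, hz.2.2.2.1⟩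
  · rintro z ⟨h1, h2, h3, h4, h5, h6, h7, h8, h9, h10⟩
    refine ⟨⟨?_, ?_, h4⟩, fun i _ => (h2 i).1, fun i _ => (h2 i).1, h8, fun i _ => (h3 i).2,
      ?_, ?_, ?_, ?_⟩
    · have := h1 0; simpa [sub_eq_zero] using this
    · intro s t _ hst
      have := h5 s t; rwa [abs_of_nonneg (sub_nonneg.2 hst)] at this
    · intro i hi
      have := h6 i hi (z.2.1 i); simpa [sub_eq_zero] using this
    · intro i hi
      have := h7 i hi (z.2.2.1 i); simpa [sub_eq_zero] using this
    · intro t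
      by_contra! hlt
      have := h9 _ (Finset.filter_subset _ _) hlt
      simp only [Set.mem_iUnion, Finset.mem_filter, Set.mem_ofPred_eq] at this
      obtain ⟨i, hi, j, hj, hij⟩ := this
      linarith [hi.2.1, hj.2.2]
    · intro i hi
      by_contra! hlt
      have := h10 i hi _ (Finset.filter_subset _ _) hlt
      simp only [Set.mem_iUnion, Finset.mem_filter, Set.mem_ofPred_eq, Set.mem_union] at this
      obtain ⟨j, hj, hij⟩ := this
      rcases hij with h | h
      · linarith [hj.2.1]
      · linarith [hj.2.2]
  · intro S hS
    have hsp : ∀ s t, 0 ≤ s → 0 ≤ t → |S.pos t - S.pos s| ≤ |t - s| := by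
      intro s t hs ht
      rcases le_total s t with h | h
      · rw [abs_of_nonneg (sub_nonneg.2 h)]; exact hS.speed s t hs h
      · rw [abs_sub_comm, abs_sub_comm t, abs_of_nonneg (sub_nonneg.2 h)]
        exact hS.speed t s ht h
    have hmx : ∀ s t : ℝ, |max t 0 - max s 0| ≤ |t - s| := fun s t => by
      simpa using abs_max_sub_max_le_max t 0 s 0
    have hu : ∀ i ∈ R, 0 ≤ S.unload i := fun i hi =>
      (hS.load_nonneg i hi).trans (hS.load_le_unload i hi)
    refine ⟨⟨fun t => S.pos (max t 0), fun i => if i ∈ R then S.load i else 0,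
      fun i => if i ∈ R then S.unload i else 0,
      S.finish⟩, ⟨?_, ?_, ?_, hS.finish_nonneg, ?_, ?_, ?_, ?_, ?_, ?_⟩, rfl⟩
    · intro t
      have := hsp 0 (max t 0) le_rfl (le_max_right _ _)
      rw [hS.start] at this
      exact this.trans (by simpa using hmx 0 t)
    · intro i
      dsimp only
      split_ifs with hi
      · exact ⟨hS.load_nonneg i hi, (hS.load_le_unload i hi).trans (hS.unload_le_finish i hi)⟩
      · exact ⟨le_rfl, hS.finish_nonneg⟩
    · intro i
      dsimp only
      split_ifs with hi
      · exact ⟨hu i hi, hS.unload_le_finish i hi⟩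
      · exact ⟨le_rfl, hS.finish_nonneg⟩
    · exact fun s t => (hsp _ _ (le_max_right _ _) (le_max_right _ _)).trans (hmx s t)
    · intro i hi s
      have h0 := hS.load_nonneg i hi
      simp only [if_pos hi]
      rw [← hS.pos_load i hi]
      refine (hsp _ _ h0 (le_max_right _ _)).trans ?_
      simpa [max_eq_left h0] using hmx (S.load i) s
    · intro i hi s
      have h0 := hu i hi
      simp only [if_pos hi]
      rw [← hS.pos_unload i hi]
      refine (hsp _ _ h0 (le_max_right _ _)).trans ?_
      simpa [max_eq_left h0] using hmx (S.unload i) s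
    · intro i hi
      simpa [if_pos hi] using hS.load_le_unload i hi
    · intro J hJ hcJ
      by_contra hno
      simp only [Set.mem_iUnion, Set.mem_ofPred_eq, not_exists, not_le] at hno
      have hJne : J.Nonempty := by
        rw [Finset.nonempty_iff_ne_empty]; rintro rfl; simp at hcJ
      obtain ⟨i, hi, him⟩ := J.exists_max_image S.load hJne
      have hsub : J ⊆ R.filter fun j => S.load j ≤ S.load i ∧ S.load i < S.unload j := by
        intro j hj
        have := hno i hi j hj
        rw [if_pos (hJ hi), if_pos (hJ hj)] at this
        exact Finset.mem_filter.2 ⟨hJ hj, him j hj, this⟩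
      have h1 := hS.capacity (S.load i)
      have h2 : (J.card : ℕ∞) ≤ _ := Nat.cast_le.2 (Finset.card_le_card hsub)
      exact absurd (hcJ.trans_le (h2.trans h1)) (lt_irrefl _)
    · intro i hi J hJ hcJ
      by_contra hno
      simp only [Set.mem_iUnion, Set.mem_ofPred_eq, not_exists, not_le, Set.mem_union,
        not_or] at hno
      have hsub : J ⊆ R.filter fun j => S.load j < S.load i ∧ S.load i < S.unload j := by
        intro j hj
        have := hno j hj
        rw [if_pos hi, if_pos (hJ hj), if_pos (hJ hj)] at this
        exact Finset.mem_filter.2 ⟨hJ hj, this⟩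
      have h1 := hS.room i hi
      have h2 : (J.card : ℕ∞) ≤ _ := Nat.cast_le.2 (Finset.card_le_card hsub)
      exact absurd (h1.trans_le (hcJ.trans h2)) (lt_irrefl _)
  · set A := |x| + ∑ i, (|σ.src i| + |σ.dst i|) with hA
    have hsd : ∀ i, |σ.src i| + |σ.dst i| ≤ A := fun i =>
      (Finset.single_le_sum (f := fun i => |σ.src i| + |σ.dst i|) (fun _ _ => by positivity)
        (Finset.mem_univ i)).trans (le_add_of_nonneg_left (abs_nonneg x))
    have hx : |x| ≤ A := le_add_of_nonneg_right (Finset.sum_nonneg fun _ _ => by positivity)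
    have hA0 : 0 ≤ A := (abs_nonneg x).trans hx
    let p : ℕ → ℝ := fun k => if k = 0 then x else
      if h : (k - 1) / 2 < σ.n then
        (if (k - 1) % 2 = 0 then σ.src ⟨(k - 1) / 2, h⟩ else σ.dst ⟨(k - 1) / 2, h⟩) else 0
    have hp : ∀ k, |p k| ≤ A := by
      intro k
      simp only [p]
      split_ifs with h1 h2
      · exact hx
      · linarith [hsd ⟨(k - 1) / 2, h2⟩, abs_nonneg (σ.dst ⟨(k - 1) / 2, h2⟩)]
      · linarith [hsd ⟨(k - 1) / 2, h2⟩, abs_nonneg (σ.src ⟨(k - 1) / 2, h2⟩)]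
      · simpa using hA0
    have hD : 0 < 2 * A + 1 := by linarith
    obtain ⟨g, hg, hgp⟩ := exists_path (2 * A + 1) hD p (fun k m => by
      have := abs_sub (p k) (p m); linarith [hp k, hp m])
    have hlt : ∀ k m : ℕ, (k : ℝ) * (2 * A + 1) < m * (2 * A + 1) ↔ k < m := fun k m => by
      rw [mul_lt_mul_iff_left₀ hD, Nat.cast_lt]
    refine ⟨⟨g, fun i => (2 * (i : ℕ) + 1 : ℕ) * (2 * A + 1),
      fun i => (2 * (i : ℕ) + 2 : ℕ) * (2 * A + 1),
      (2 * σ.n + 1 : ℕ) * (2 * A + 1)⟩, ⟨?_, fun s t _ h => hg s t h, by positivity⟩,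
      fun i _ => by positivity, fun i _ => by positivity, fun i _ => ?_, fun i _ => ?_,
      fun i _ => ?_, fun i _ => ?_, ?_, ?_⟩
    · simpa [p] using hgp 0
    · dsimp only
      gcongr
      omega
    · have := i.2
      exact mul_le_mul_of_nonneg_right (Nat.cast_le.2 (by omega)) hD.le
    · exact (hgp _).trans (by simp [p])
    · refine (hgp _).trans ?_
      have : (2 * (i : ℕ) + 1) / 2 = i := by omega
      simp [p, this]
    · intro t
      refine le_trans ?_ hc
      rw [Nat.cast_le_one, Finset.card_le_one]
      intro a ha b hb
      simp only [Finset.mem_filter] at ha hb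
      have h1 := (hlt _ _).1 (ha.2.1.trans_lt hb.2.2)
      have h2 := (hlt _ _).1 (hb.2.1.trans_lt ha.2.2)
      ext; omega
    · intro i hi
      refine lt_of_lt_of_le ?_ hc
      rw [Nat.cast_lt_one, Finset.card_eq_zero, Finset.filter_eq_empty_iff]
      rintro j - ⟨h1, h2⟩
      rw [hlt] at h1 h2
      omega

/-- Shortest schedules always exist, so there is a way of choosing among them. -/
theorem TieBreaking.nonempty (c : ℕ∞) (hc : 1 ≤ c) : Nonempty (TieBreaking c) := by
  choose f hf using exists_sched c hc
  choose g hg using exists_back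
  exact ⟨⟨f, g, hf, hg⟩⟩

end DialARide

end

/-!
The adversary exploits that a server carrying a request from `0` to `1` cannot return to the origin
early. `Lazy(α)` picks this request up at time about `α`. Meanwhile a request at `-u` and a ride
from `-a` to `0` appear, where `u` and `2 * a` are close to `α`; a server that went to `-u` at once
serves them on its way back, carries the first request to `1` at time `2 * u + 1`, and ends in `2`
at time `2 * u + 2`, where the two last requests are released.

When the first of these becomes known, `Lazy(α)` is in `1` and does not leave before time
`α * (2 * u + 2)`. As `2 * a < u`, every shortest schedule visits `2`, then serves the ride from
`-a` to `0`, and serves `-u` last: the opposite order costs `3 + 2 * u` instead of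
`3 + 2 * a + u`. The last request is released during this tour and calls the server back from `-u`
to `2`, so the ratio is at least `α + (5 + 2 * a + 2 * u) / (2 * u + 2)`, which tends to
`2 + α + (1 - α) / (2 + 2 * α)`.
-/

open Filter Set Topology
open scoped NNReal

theorem exists_lipschitzWith_apply_eq {ι X : Type*} [PseudoMetricSpace X] {K : ℝ≥0} {x : ι → X}
    {y : ι → ℝ} (h : ∀ i j, dist (y i) (y j) ≤ K * dist (x i) (x j)) :
    ∃ g : X → ℝ, LipschitzWith K g ∧ ∀ i, g (x i) = y i := by
  have hfactors : y.FactorsThrough x := fun i j hij =>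
    dist_le_zero.1 (by simpa only [hij, dist_self, mul_zero] using h i j)
  have hextend : ∀ i, Function.extend x y 0 (x i) = y i := hfactors.extend_apply 0
  have hlip : LipschitzOnWith K (Function.extend x y 0) (range x) :=
    LipschitzOnWith.of_dist_le_mul <| by
      rintro _ ⟨i, rfl⟩ _ ⟨j, rfl⟩
      simpa only [hextend] using h i j
  obtain ⟨g, hg, heq⟩ := hlip.extend_real
  exact ⟨g, hg, fun i => (heq (mem_range_self i)).symm.trans (hextend i)⟩

namespace DialARide

namespace Schedule

variable {n : ℕ} {S : Schedule n} {x : ℝ}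

theorem IsMotion.of_lipschitzWith (hpos : LipschitzWith 1 S.pos) (hstart : S.pos 0 = x)
    (hfinish : 0 ≤ S.finish) : S.IsMotion x where
  start := hstart
  speed s t _ hst := by
    simpa only [NNReal.coe_one, one_mul, Real.dist_eq, abs_of_nonneg (sub_nonneg.2 hst)]
      using hpos.dist_le_mul t s
  finish_nonneg := hfinish

theorem IsMotion.add_abs_pos_sub_le_or (hS : S.IsMotion x) {s t : ℝ} (hs : 0 ≤ s)
    (ht : 0 ≤ t) : s + |S.pos t - S.pos s| ≤ t ∨ t + |S.pos t - S.pos s| ≤ s := by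
  rcases le_total s t with hst | hts
  · exact .inl (by linarith [hS.speed s t hs hst])
  · exact .inr (by linarith [hS.speed t s ht hts, abs_sub_comm (S.pos t) (S.pos s)])

theorem IsMotion.abs_pos_sub_start_le (hS : S.IsMotion x) {t : ℝ} (ht : 0 ≤ t) :
    |S.pos t - x| ≤ t := by
  simpa only [hS.start, sub_zero] using hS.speed 0 t le_rfl ht

end Schedule

section Serves

variable {c : ℕ∞} {σ : RequestSeq} {rel : Fin σ.n → ℝ} {R : Finset (Fin σ.n)} {x : ℝ}
  {S : Schedule σ.n} {i : Fin σ.n}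

theorem Schedule.Serves.unload_nonneg (hS : S.Serves c σ rel R x) (hi : i ∈ R) : 0 ≤ S.unload i :=
  (hS.load_nonneg i hi).trans (hS.load_le_unload i hi)

theorem Schedule.Serves.abs_src_sub_le_load (hS : S.Serves c σ rel R x) (hi : i ∈ R) :
    |σ.src i - x| ≤ S.load i :=
  hS.pos_load i hi ▸ hS.abs_pos_sub_start_le (hS.load_nonneg i hi)

theorem Schedule.Serves.load_add_abs_dst_sub_src_le_unload (hS : S.Serves c σ rel R x)
    (hi : i ∈ R) : S.load i + |σ.dst i - σ.src i| ≤ S.unload i := by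
  have hspeed := hS.speed _ _ (hS.load_nonneg i hi) (hS.load_le_unload i hi)
  rw [hS.pos_load i hi, hS.pos_unload i hi] at hspeed
  linarith

theorem Schedule.Serves.of_disjoint_rides (hc : 1 ≤ c) (hmotion : S.IsMotion x)
    (hload : ∀ i ∈ R, 0 ≤ S.load i ∧ rel i ≤ S.load i ∧ S.pos (S.load i) = σ.src i)
    (hunload : ∀ i ∈ R, S.load i ≤ S.unload i ∧ S.unload i ≤ S.finish ∧
      S.pos (S.unload i) = σ.dst i)
    (hdisj : ∀ i ∈ R, ∀ j ∈ R, i ≠ j → S.unload i ≤ S.load j ∨ S.unload j ≤ S.load i) :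
    S.Serves c σ rel R x where
  toIsMotion := hmotion
  load_nonneg i hi := (hload i hi).1
  rel_le_load i hi := (hload i hi).2.1
  load_le_unload i hi := (hunload i hi).1
  unload_le_finish i hi := (hunload i hi).2.1
  pos_load i hi := (hload i hi).2.2
  pos_unload i hi := (hunload i hi).2.2
  capacity t := by
    refine le_trans (Nat.cast_le_one.2 (Finset.card_le_one.2 fun i hi j hj => ?_)) hc
    rw [Finset.mem_filter] at hi hj
    by_contra hij
    rcases hdisj i hi.1 j hj.1 hij with h | h <;> linarith [hi.2.1, hi.2.2, hj.2.1, hj.2.2]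
  room i hi := by
    refine lt_of_lt_of_le (Nat.cast_lt_one.2 (Finset.card_eq_zero.2 ?_)) hc
    refine Finset.filter_eq_empty_iff.2 fun j hj ⟨hji, hij⟩ => ?_
    rcases hdisj i hi j hj (fun h => hji.ne (h ▸ rfl)) with h | h
    · linarith [(hunload i hi).1]
    · exact h.not_gt hij

theorem exists_serves_singleton (hc : 1 ≤ c) (rel : Fin σ.n → ℝ) (i : Fin σ.n) (x : ℝ) :
    ∃ S, Schedule.Serves c σ rel {i} x S ∧
      S.finish = max (rel i) |σ.src i - x| + |σ.dst i - σ.src i| := by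
  set ℓ := max (rel i) |σ.src i - x|
  have hℓ : |σ.src i - x| ≤ ℓ := le_max_right _ _
  have hℓ₀ : 0 ≤ ℓ := (abs_nonneg _).trans hℓ
  obtain ⟨g, hg, hgx⟩ : ∃ g : ℝ → ℝ, LipschitzWith 1 g ∧ ∀ k : Fin 3,
      g (![0, ℓ, ℓ + |σ.dst i - σ.src i|] k) = ![x, σ.src i, σ.dst i] k := by
    refine exists_lipschitzWith_apply_eq fun j k => ?_
    rw [NNReal.coe_one, one_mul, Real.dist_eq, Real.dist_eq]
    fin_cases j <;> fin_cases k <;> simp <;> grind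
  let S : Schedule σ.n :=
    ⟨g, fun _ => ℓ, fun _ => ℓ + |σ.dst i - σ.src i|, ℓ + |σ.dst i - σ.src i|⟩
  have hmotion : S.IsMotion x :=
    .of_lipschitzWith hg (hgx 0) (add_nonneg hℓ₀ (abs_nonneg _))
  refine ⟨S, .of_disjoint_rides hc hmotion ?_ ?_ ?_, rfl⟩
  · simp only [Finset.mem_singleton, forall_eq]
    exact ⟨hℓ₀, le_max_left _ _, hgx 1⟩
  · simp only [Finset.mem_singleton, forall_eq]
    exact ⟨le_add_of_nonneg_right (abs_nonneg _), le_rfl, hgx 2⟩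
  · simp only [Finset.mem_singleton]
    rintro j rfl k rfl hjk
    exact absurd rfl hjk

theorem Schedule.Serves.max_add_le_finish (hS : S.Serves c σ rel R x) (hi : i ∈ R) :
    max (rel i) |σ.src i - x| + |σ.dst i - σ.src i| ≤ S.finish := by
  have hload : max (rel i) |σ.src i - x| ≤ S.load i :=
    max_le (hS.rel_le_load i hi) (hS.abs_src_sub_le_load hi)
  linarith [hS.load_add_abs_dst_sub_src_le_unload hi, hS.unload_le_finish i hi]

theorem optOf_eq_of_isShortest (hS : S.IsShortest (Schedule.Serves c σ σ.release R 0)) :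
    optOf c σ R = S.finish :=
  IsLeast.csInf_eq ⟨⟨S, hS.1, rfl⟩, by rintro _ ⟨S', hS', rfl⟩; exact hS.2 S' hS'⟩

theorem optOf_singleton (hc : 1 ≤ c) (i : Fin σ.n) :
    optOf c σ {i} = max (σ.release i) |σ.src i| + |σ.dst i - σ.src i| := by
  obtain ⟨S, hS, hfinish⟩ := exists_serves_singleton hc σ.release i 0
  rw [sub_zero] at hfinish
  rw [← hfinish]
  refine optOf_eq_of_isShortest ⟨hS, fun S' hS' => ?_⟩
  simpa only [hfinish, sub_zero] using hS'.max_add_le_finish (Finset.mem_singleton_self i)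

theorem Schedule.IsShortest.singleton_eq (hc : 1 ≤ c)
    (hS : S.IsShortest (Schedule.Serves c σ rel {i} x)) :
    S.load i = max (rel i) |σ.src i - x| ∧ S.unload i = S.load i + |σ.dst i - σ.src i| ∧
      S.finish = S.unload i := by
  have hi := Finset.mem_singleton_self i
  obtain ⟨S', hS', hfinish⟩ := exists_serves_singleton hc rel i x
  have hle := hS.2 S' hS'
  have hride := hS.1.load_add_abs_dst_sub_src_le_unload hi
  have hlast := hS.1.unload_le_finish i hi
  have hload : max (rel i) |σ.src i - x| ≤ S.load i :=
    max_le (hS.1.rel_le_load i hi) (hS.1.abs_src_sub_le_load hi)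
  exact ⟨by linarith, by linarith, by linarith⟩

end Serves

section Delivers

variable {σ : RequestSeq} {L : Finset (Fin σ.n)} {x : ℝ} {S : Schedule σ.n} {i : Fin σ.n}

theorem Schedule.Delivers.abs_start_le_finish (hS : S.Delivers σ L x) : |x| ≤ S.finish := by
  simpa only [hS.pos_finish, zero_sub, abs_neg] using hS.abs_pos_sub_start_le hS.finish_nonneg

theorem Schedule.Delivers.abs_dst_sub_add_abs_dst_le_finish (hS : S.Delivers σ L x)
    (hi : i ∈ L) : |σ.dst i - x| + |σ.dst i| ≤ S.finish := by
  have hto := hS.abs_pos_sub_start_le (hS.unload_nonneg i hi)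
  have hback := hS.speed _ _ (hS.unload_nonneg i hi) (hS.unload_le_finish i hi)
  rw [hS.pos_unload i hi] at hto hback
  rw [hS.pos_finish, zero_sub, abs_neg] at hback
  linarith

end Delivers

/-- At time `t` the server in state `q` is empty and in `p`, the first `m` requests have arrived,
and those in `V` have been served. -/
structure State.IsEmptyAt {n : ℕ} (q : State n) (t : ℝ) (m : ℕ) (p : ℝ) (V : Finset (Fin n)) :
    Prop where
  arrived : q.arrived = m
  posAt : q.posAt t = p
  loadedAt : q.loadedAt t = ∅
  servedAt : q.servedAt t = V

/-- The algorithm gets from the first state to the second by processing some number of events. -/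
abbrev Reaches {c : ℕ∞} (τ : TieBreaking c) (α : ℝ) (σ : RequestSeq) :
    State σ.n → State σ.n → Prop :=
  Relation.ReflTransGen fun q q' => step τ α σ q = q'

/-- `CompletedBy` for the run that continues from the state `q`. -/
def CompletedFrom {c : ℕ∞} (τ : TieBreaking c) (α : ℝ) (σ : RequestSeq) (q : State σ.n)
    (T : ℝ) : Prop :=
  ∃ q', Reaches τ α σ q q' ∧ q'.arrived = σ.n ∧ q'.start ≤ T ∧ q'.servedAt T = Finset.univ

section IsEmptyAt

variable {c : ℕ∞} {σ : RequestSeq} {q : State σ.n}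

theorem State.isEmptyAt_of_followSchedule {rel : Fin σ.n → ℝ} {R : Finset (Fin σ.n)}
    {S : Schedule σ.n} {x : ℝ} (hcmd : q.cmd = .followSchedule R S)
    (hS : S.Serves c σ rel R x) :
    q.IsEmptyAt (q.start + S.finish) q.arrived (S.pos S.finish) (q.served ∪ R) where
  arrived := rfl
  posAt := by simp only [State.posAt, hcmd, add_sub_cancel_left]
  loadedAt := by
    simp only [State.loadedAt, hcmd]
    refine Finset.filter_eq_empty_iff.2 fun i hi h => ?_
    linarith [hS.unload_le_finish i hi, h.2]
  servedAt := by
    simp only [State.servedAt, hcmd]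
    rw [Finset.filter_true_of_mem fun i hi => by gcongr; exact hS.unload_le_finish i hi]

theorem State.isEmptyAt_of_deliverAndReturn {S : Schedule σ.n} {x : ℝ}
    (hcmd : q.cmd = .deliverAndReturn S) (hS : S.Delivers σ q.loaded x) :
    q.IsEmptyAt (q.start + S.finish) q.arrived 0 (q.served ∪ q.loaded) where
  arrived := rfl
  posAt := by simp only [State.posAt, hcmd, add_sub_cancel_left, hS.pos_finish]
  loadedAt := by
    simp only [State.loadedAt, hcmd]
    refine Finset.filter_eq_empty_iff.2 fun i hi h => ?_
    linarith [hS.unload_le_finish i hi]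
  servedAt := by
    simp only [State.servedAt, hcmd]
    rw [Finset.filter_true_of_mem fun i hi => by gcongr; exact hS.unload_le_finish i hi]

end IsEmptyAt

section Step

variable {c : ℕ∞} {τ : TieBreaking c} {α : ℝ} {σ : RequestSeq} {q q' : State σ.n} {t T : ℝ}
  {m : ℕ} {p : ℝ} {V : Finset (Fin σ.n)}

theorem arrived_uponIdle : (uponIdle τ α σ t q).arrived = q.arrived := by
  unfold uponIdle; split_ifs <;> rfl

theorem start_uponIdle : (uponIdle τ α σ t q).start = t := by
  unfold uponIdle; split_ifs <;> rfl

theorem le_endTime_uponIdle : (t : WithTop ℝ) ≤ (uponIdle τ α σ t q).endTime := by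
  unfold uponIdle
  split_ifs with hwait
  · exact WithTop.coe_le_coe.2 hwait.le
  · exact WithTop.coe_le_coe.2 (le_add_of_nonneg_right (τ.sched_shortest _ _ _).1.finish_nonneg)
  · exact le_top

theorem arrived_le_uponRequest : q.arrived ≤ (uponRequest τ α σ t q).arrived := by
  unfold uponRequest
  dsimp only
  split_ifs
  · exact Nat.le_succ _
  · split
    · exact arrived_uponIdle.symm ▸ Nat.le_succ _
    · exact Nat.le_succ _

theorem arrived_le_step : q.arrived ≤ (step τ α σ q).arrived := by
  unfold step
  split_ifs
  · exact arrived_le_uponRequest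
  · exact le_rfl
  · exact arrived_uponIdle.ge

theorem arrived_le_of_reaches (h : Reaches τ α σ q q') : q.arrived ≤ q'.arrived := by
  induction h with
  | refl => exact le_rfl
  | tail _ hstep ih => exact hstep ▸ ih.trans arrived_le_step

theorem step_of_request {i : Fin σ.n} (hi : q.arrived = i)
    (hrelease : (σ.release i : WithTop ℝ) ≤ q.endTime) :
    step τ α σ q = uponRequest τ α σ (σ.release i) q := by
  have hlt : q.arrived < σ.n := hi ▸ i.2
  have heq : (⟨q.arrived, hlt⟩ : Fin σ.n) = i := Fin.ext hi
  rw [step, dif_pos ⟨hlt, heq ▸ hrelease⟩, heq]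

theorem step_of_idle {e : ℝ} (hend : q.endTime = e)
    (hlater : ∀ i : Fin σ.n, q.arrived = i → e < σ.release i) :
    step τ α σ q = uponIdle τ α σ e q := by
  have hnone : ¬∃ h : q.arrived < σ.n, (σ.release ⟨q.arrived, h⟩ : WithTop ℝ) ≤ q.endTime := by
    rintro ⟨hlt, hle⟩
    rw [hend, WithTop.coe_le_coe] at hle
    exact (hlater ⟨q.arrived, hlt⟩ rfl).not_ge hle
  have hne : q.endTime ≠ ⊤ := hend ▸ WithTop.coe_ne_top
  rw [step, dif_neg hnone, dif_neg hne]
  simp only [hend, WithTop.untop_coe]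

theorem step_of_continue {i : Fin σ.n} (hi : q.arrived = i) (hcmd : q.cmd ≠ .rest)
    (hrelease : (σ.release i : WithTop ℝ) ≤ q.endTime)
    (hback : α * opt c σ (σ.release i) < σ.release i +
      (τ.back σ (q.loadedAt (σ.release i)) (q.posAt (σ.release i))).finish) :
    step τ α σ q = { q with arrived := q.arrived + 1 } := by
  rw [step_of_request hi hrelease, uponRequest, if_neg hback.not_ge]
  cases hq : q.cmd with
  | rest => exact absurd hq hcmd
  | _ => rfl

theorem uponIdle_eq_waitUntil (hq : q.IsEmptyAt t m p V) (h : t < α * opt c σ t) :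
    uponIdle τ α σ t q = ⟨m, .waitUntil (α * opt c σ t), t, p, ∅, V⟩ := by
  rw [uponIdle, if_pos h, State.execute, hq.arrived, hq.posAt, hq.loadedAt, hq.servedAt]

theorem uponIdle_eq_followSchedule (hq : q.IsEmptyAt t m p V) (h : α * opt c σ t ≤ t)
    {U : Finset (Fin σ.n)} (hU : (Finset.univ.filter fun i : Fin σ.n => (i : ℕ) < m) \ V = U)
    (hne : U.Nonempty) :
    uponIdle τ α σ t q = ⟨m, .followSchedule U (τ.sched σ U p), t, p, ∅, V⟩ := by
  have hunserved : q.unservedAt t = U := by rw [State.unservedAt, hq.arrived, hq.servedAt, hU]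
  rw [uponIdle, if_neg h.not_gt, hunserved, if_pos hne.ne_empty, State.execute, hq.arrived,
    hq.posAt, hq.loadedAt, hq.servedAt]

theorem reaches_followSchedule (hq : q.IsEmptyAt t m p V) {U : Finset (Fin σ.n)}
    (hU : (Finset.univ.filter fun i : Fin σ.n => (i : ℕ) < m) \ V = U) (hne : U.Nonempty)
    (hT : max t (α * opt c σ t) = T) (hopt : opt c σ T = opt c σ t)
    (hlater : ∀ i : Fin σ.n, m = i → T < σ.release i) :
    Reaches τ α σ (uponIdle τ α σ t q)
      ⟨m, .followSchedule U (τ.sched σ U p), T, p, ∅, V⟩ := by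
  rcases lt_or_ge t (α * opt c σ t) with hwait | hgo
  · obtain rfl : α * opt c σ t = T := by rw [← hT, max_eq_right hwait.le]
    rw [uponIdle_eq_waitUntil hq hwait]
    refine .single ?_
    rw [step_of_idle rfl hlater]
    exact uponIdle_eq_followSchedule ⟨rfl, rfl, rfl, rfl⟩ (by rw [hopt]) hU hne
  · obtain rfl : t = T := by rw [← hT, max_eq_left hgo]
    rw [uponIdle_eq_followSchedule hq hgo hU hne]

theorem finish_back_empty_zero : (τ.back σ ∅ 0).finish = 0 := by
  obtain ⟨hback, hmin⟩ := τ.back_shortest σ ∅ 0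
  refine le_antisymm (hmin ⟨fun _ => 0, fun _ => 0, fun _ => 0, 0⟩ ?_) hback.finish_nonneg
  exact ⟨⟨rfl, fun s t _ hst => by simpa using hst, le_rfl⟩, by simp, by simp, by simp, rfl⟩

theorem exists_reaches_uponIdle_of_rest (i : Fin σ.n) (s : ℝ) (V : Finset (Fin σ.n)) :
    ∃ q', Reaches τ α σ ⟨i, .rest, s, 0, ∅, V⟩ (uponIdle τ α σ (σ.release i) q') ∧
      q'.IsEmptyAt (σ.release i) (i + 1) 0 V := by
  have hrequest : step τ α σ ⟨i, .rest, s, 0, ∅, V⟩ =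
      uponRequest τ α σ (σ.release i) ⟨i, .rest, s, 0, ∅, V⟩ := step_of_request rfl le_top
  by_cases hreturn : σ.release i + (τ.back σ ∅ 0).finish ≤ α * opt c σ (σ.release i)
  · let q' : State σ.n := ⟨i + 1, .deliverAndReturn (τ.back σ ∅ 0), σ.release i, 0, ∅, V⟩
    have hstep : step τ α σ ⟨i, .rest, s, 0, ∅, V⟩ = q' := hrequest.trans (if_pos hreturn)
    have hend : σ.release i + (τ.back σ ∅ 0).finish = σ.release i := by
      rw [finish_back_empty_zero, add_zero]
    have hempty := State.isEmptyAt_of_deliverAndReturn (q := q') rfl (τ.back_shortest σ ∅ 0).1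
    rw [show q'.start + _ = _ from hend, Finset.union_empty] at hempty
    refine ⟨q', .tail (.single hstep) ?_, hempty⟩
    refine step_of_idle (congrArg _ hend) fun j hj => σ.release_strictMono ?_
    exact Fin.lt_def.2 (hj ▸ Nat.lt_succ_self _)
  · exact ⟨⟨i + 1, .rest, s, 0, ∅, V⟩, .single (hrequest.trans (if_neg hreturn)),
      ⟨rfl, rfl, rfl, rfl⟩⟩

end Step

section Completion

variable {c : ℕ∞} {τ : TieBreaking c} {α : ℝ} {σ : RequestSeq} {q q' : State σ.n} {B T : ℝ}

theorem CompletedBy.completedFrom (h : CompletedBy τ α σ T) :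
    CompletedFrom τ α σ (initState σ.n) T := by
  obtain ⟨k, hk⟩ := h
  suffices hrun : ∀ k, Reaches τ α σ (initState σ.n) (run τ α σ k) from ⟨_, hrun k, hk⟩
  intro k
  induction k with
  | zero => exact .refl
  | succ k ih => exact ih.tail (Function.iterate_succ_apply' _ _ _).symm

theorem CompletedFrom.of_reaches (h : CompletedFrom τ α σ q T) (hreach : Reaches τ α σ q q')
    (hlt : q'.arrived < σ.n) : CompletedFrom τ α σ q' T := by
  obtain ⟨r, hr, harrived, hserved⟩ := h
  rcases hreach.total_of_right_unique (fun _ _ _ h₁ h₂ => h₁.symm.trans h₂) hr with hq' | hr'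
  · exact ⟨r, hq', harrived, hserved⟩
  · exact absurd (harrived.ge.trans (arrived_le_of_reaches hr')) hlt.not_ge

theorem completedFrom_step (h : CompletedFrom τ α σ q T) (hq : q.servedAt T ≠ Finset.univ) :
    CompletedFrom τ α σ (step τ α σ q) T := by
  obtain ⟨r, hr, harrived, hstart, hserved⟩ := h
  rcases hr.cases_head with rfl | ⟨_, rfl, hr⟩
  · exact absurd hserved hq
  · exact ⟨r, hr, harrived, hstart, hserved⟩

theorem step_of_arrived (hq : σ.n ≤ q.arrived) :
    step τ α σ q = q ∨
      ∃ e : ℝ, q.endTime = e ∧ step τ α σ q = uponIdle τ α σ e q := by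
  cases hend : q.endTime with
  | top =>
    left
    rw [step, dif_neg fun ⟨h, _⟩ => hq.not_gt h, dif_pos hend]
  | coe e => exact .inr ⟨e, rfl, step_of_idle hend fun i hi => absurd i.2 (hi ▸ hq.not_gt)⟩

theorem CompletedFrom.le (h : CompletedFrom τ α σ q T) (hq : σ.n ≤ q.arrived)
    (hend : (B : WithTop ℝ) ≤ q.endTime)
    (hserved : q.start ≤ T → q.servedAt T = Finset.univ → B ≤ T) : B ≤ T := by
  obtain ⟨r, hr, _, hstart, hrserved⟩ := h
  induction hr using Relation.ReflTransGen.head_induction_on with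
  | refl => exact hserved hstart hrserved
  | head hstep _ ih =>
    subst hstep
    rcases step_of_arrived (τ := τ) (α := α) hq with hstay | ⟨e, he, hidle⟩
    · rw [hstay] at ih
      exact ih hq hend hserved
    · rw [he] at hend
      rw [hidle] at ih
      refine ih (arrived_uponIdle.symm ▸ hq) (hend.trans le_endTime_uponIdle) fun hT _ => ?_
      exact (WithTop.coe_le_coe.1 hend).trans (start_uponIdle.ge.trans hT)

theorem ofReal_div_optOf_le_competitiveRatio (hn : 0 < σ.n)
    (hopt : 0 < optOf c σ Finset.univ) (hB : ∀ T, CompletedBy τ α σ T → B ≤ T) :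
    ENNReal.ofReal (B / optOf c σ Finset.univ) ≤ competitiveRatio τ α := by
  rw [ENNReal.ofReal_div_of_pos hopt]
  have hcost : ENNReal.ofReal B ≤ lazyCost τ α σ :=
    le_iInf₂ fun T hT => ENNReal.ofReal_le_ofReal (hB T hT)
  exact (ENNReal.div_le_div_right hcost _).trans
    (le_iSup₂ (f := fun (σ : RequestSeq) (_ : 0 < σ.n) =>
      lazyCost τ α σ / ENNReal.ofReal (optOf c σ Finset.univ)) σ hn)

end Completion

/-- Parameters of the lower bound construction: the first request is released at time `t₀`, the
leftmost point that is visited is `-u`, and the ride from `-a` to `0` forces a detour of length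
`2 * a`.  The ratio `2 + α + (1 - α) / (2 + 2 * α)` is approached as `u` and `2 * a` tend to `α`. -/
structure Adversary (α : ℝ) where
  t₀ : ℝ
  u : ℝ
  a : ℝ
  alpha_nonneg : 0 ≤ α
  alpha_lt_one : α < 1
  t₀_pos : 0 < t₀
  t₀_lt_u : t₀ < u
  alpha_mul_lt_u : α * (t₀ + 1) < u
  u_le_one : u ≤ 1
  a_nonneg : 0 ≤ a
  two_mul_a_lt_u : 2 * a < u
  two_mul_u_sub_a_lt : 2 * u - a < α + 1

namespace Adversary

variable {α : ℝ} (A : Adversary α)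

/-- The time at which `Lazy(α)` picks up the first request. -/
def pickup : ℝ := max A.t₀ (α * (A.t₀ + 1))

/-- The release time of the fourth request: `Lazy(α)` has delivered the first request, and it is
about to leave for the next two. -/
def t₃ : ℝ := max (A.pickup + 1) (α * (2 * A.u + 1))

theorem alpha_le_pickup : α ≤ A.pickup :=
  (le_mul_of_one_le_right A.alpha_nonneg (by linarith [A.t₀_pos])).trans (le_max_right _ _)

theorem t₀_le_pickup : A.t₀ ≤ A.pickup := le_max_left _ _

theorem pickup_lt_u : A.pickup < A.u := max_lt A.t₀_lt_u A.alpha_mul_lt_u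

theorem pickup_add_one_le_t₃ : A.pickup + 1 ≤ A.t₃ := le_max_left _ _

theorem two_mul_u_sub_a_lt_pickup_add_one : 2 * A.u - A.a < A.pickup + 1 := by
  linarith [A.two_mul_u_sub_a_lt, A.alpha_le_pickup]

theorem u_pos : 0 < A.u := A.t₀_pos.trans A.t₀_lt_u

theorem alpha_mul_lt_two_mul_u_add_two : α * (2 * A.u + 2) < 2 * A.u + 2 :=
  mul_lt_of_lt_one_left (by linarith [A.u_pos]) A.alpha_lt_one

theorem t₃_lt : A.t₃ < 2 * A.u + 2 :=
  max_lt (by linarith [A.pickup_lt_u, A.u_pos])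
    (by linarith [A.alpha_mul_lt_two_mul_u_add_two, A.alpha_nonneg])

theorem u_lt_t₃ : A.u < A.t₃ := by
  linarith [A.u_le_one, A.pickup_add_one_le_t₃, A.t₀_pos, A.t₀_le_pickup]

/-- The requests of the construction. -/
abbrev seq : RequestSeq where
  n := 5
  src := ![0, -A.u, -A.a, 2, 2]
  dst := ![1, -A.u, 0, 2, 2]
  release := ![A.t₀, A.u, 2 * A.u - A.a, A.t₃, 2 * A.u + 2]
  release_pos := by
    have := A.t₀_pos
    have := A.u_pos
    have := A.two_mul_a_lt_u
    have := A.a_nonneg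
    have := A.pickup_add_one_le_t₃
    have := A.t₀_le_pickup
    intro i
    fin_cases i <;> simp <;> linarith
  release_strictMono := by
    have := A.t₀_lt_u
    have := A.two_mul_a_lt_u
    have := A.a_nonneg
    have := A.two_mul_u_sub_a_lt_pickup_add_one
    have := A.pickup_add_one_le_t₃
    have := A.t₃_lt
    refine Fin.strictMono_iff_lt_succ.2 fun i => ?_
    fin_cases i <;> simp <;> linarith

/-- An optimal offline schedule, stopped at time `T`: the server visits `-u` before anything else
and then moves to the right. -/
def offline (T : ℝ) : Schedule A.seq.n where
  pos t := |t - A.u| - A.u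
  load := ![2 * A.u, A.u, 2 * A.u - A.a, 2 * A.u + 2, 2 * A.u + 2]
  unload := ![2 * A.u + 1, A.u, 2 * A.u, 2 * A.u + 2, 2 * A.u + 2]
  finish := T

theorem offline_serves {c : ℕ∞} (hc : 1 ≤ c) {R : Finset (Fin A.seq.n)} {T : ℝ} (hT₀ : 0 ≤ T)
    (hT : ∀ i ∈ R, (A.offline T).unload i ≤ T) :
    (A.offline T).Serves c A.seq A.seq.release R 0 := by
  have hu := A.u_pos
  have ht₀ := A.t₀_lt_u
  have ha := A.a_nonneg
  have hau := A.two_mul_a_lt_u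
  have ht₃ := A.t₃_lt
  refine .of_disjoint_rides hc (.of_lipschitzWith ?_ ?_ hT₀) ?_ ?_ ?_
  · refine .of_dist_le_mul fun s t => ?_
    simp only [offline, Real.dist_eq, NNReal.coe_one, one_mul]
    grind
  · simp [offline, abs_of_pos hu]
  · intro i _
    fin_cases i <;> simp [offline] <;> grind
  · intro i hi
    refine ⟨?_, hT i hi, ?_⟩ <;> clear hi <;> fin_cases i <;> simp [offline] <;> grind
  · intro i _ j _
    fin_cases i <;> fin_cases j <;> simp [offline] <;> grind

theorem two_mul_u_add_dst_le_finish {c : ℕ∞} {R : Finset (Fin A.seq.n)} {S : Schedule A.seq.n}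
    (hS : S.Serves c A.seq A.seq.release R 0) (h₁ : 1 ∈ R) {i : Fin A.seq.n} (hi : i ∈ R)
    (hdst : 1 ≤ A.seq.dst i) : 2 * A.u + A.seq.dst i ≤ S.finish := by
  have hrelease : A.u ≤ S.load 1 := hS.rel_le_load 1 h₁
  have hload : S.pos (S.load 1) = -A.u := hS.pos_load 1 h₁
  have hlast₁ := (hS.load_le_unload 1 h₁).trans (hS.unload_le_finish 1 h₁)
  have hlast := hS.unload_le_finish i hi
  have hreach := hS.abs_pos_sub_start_le (hS.unload_nonneg hi)
  have hbetween := hS.add_abs_pos_sub_le_or (hS.load_nonneg 1 h₁) (hS.unload_nonneg hi)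
  rw [hS.pos_unload i hi, sub_zero, abs_of_pos (by linarith)] at hreach
  rw [hS.pos_unload i hi, hload, sub_neg_eq_add,
    abs_of_pos (by linarith [A.u_pos])] at hbetween
  rcases hbetween with h | h <;> linarith [A.u_le_one]

section Opt

variable {c : ℕ∞} {t : ℝ}

theorem optOf_eq_two_mul_u_add_dst (hc : 1 ≤ c) {R : Finset (Fin A.seq.n)} (h₁ : 1 ∈ R)
    {i : Fin A.seq.n} (hi : i ∈ R) (hdst : 1 ≤ A.seq.dst i)
    (hunload : ∀ j ∈ R, (A.offline (2 * A.u + A.seq.dst i)).unload j ≤ 2 * A.u + A.seq.dst i) :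
    optOf c A.seq R = 2 * A.u + A.seq.dst i :=
  optOf_eq_of_isShortest ⟨A.offline_serves hc (by linarith [A.u_pos]) hunload,
    fun _ hS => A.two_mul_u_add_dst_le_finish hS h₁ hi hdst⟩

theorem opt_eq_of_lt_u (hc : 1 ≤ c) (ht₀ : A.t₀ ≤ t) (ht : t < A.u) :
    opt c A.seq t = A.t₀ + 1 := by
  have hreleased : (Finset.univ.filter fun i => A.seq.release i ≤ t) = {0} := by
    ext i
    have := A.two_mul_a_lt_u
    have := A.u_lt_t₃
    have := A.u_pos
    fin_cases i <;> simp <;> linarith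
  rw [opt, hreleased, optOf_singleton hc]
  simp [A.t₀_pos.le]

theorem opt_eq_of_u_le (hc : 1 ≤ c) (hu : A.u ≤ t) (ht : t < A.t₃) :
    opt c A.seq t = 2 * A.u + 1 := by
  have := A.t₀_lt_u
  have := A.t₃_lt
  have := A.u_pos
  refine A.optOf_eq_two_mul_u_add_dst hc (i := 0) ?_ ?_ le_rfl fun j hj => ?_
  · simpa using hu
  · exact Finset.mem_filter.2 ⟨Finset.mem_univ _, show A.t₀ ≤ t by linarith⟩
  · have := A.a_nonneg
    fin_cases j <;> simp [offline] at hj ⊢ <;> linarith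

theorem optOf_eq_of_mem (hc : 1 ≤ c) {R : Finset (Fin A.seq.n)} (h₁ : 1 ∈ R) (h₃ : 3 ∈ R) :
    optOf c A.seq R = 2 * A.u + 2 := by
  have := A.u_pos
  refine A.optOf_eq_two_mul_u_add_dst hc h₁ h₃ one_le_two fun j _ => ?_
  fin_cases j <;> simp [offline]
  linarith

theorem opt_eq_of_t₃_le (hc : 1 ≤ c) (ht : A.t₃ ≤ t) : opt c A.seq t = 2 * A.u + 2 := by
  have hu : A.u ≤ t := A.u_lt_t₃.le.trans ht
  exact A.optOf_eq_of_mem hc (by simpa using hu) (by simpa using ht)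

end Opt

/-- A shortest way to serve the second, third and fourth request from `1`: the server visits `2`,
`-a`, `0` and `-u`, in this order. -/
def detour : Schedule A.seq.n where
  pos t := max (2 - |t - 1|) (-|t - (3 + 2 * A.a)|)
  load := ![0, 3 + 2 * A.a + A.u, 3 + A.a, 1, 0]
  unload := ![0, 3 + 2 * A.a + A.u, 3 + 2 * A.a, 1, 0]
  finish := 3 + 2 * A.a + A.u

theorem detour_serves {c : ℕ∞} (hc : 1 ≤ c) :
    A.detour.Serves c A.seq (fun _ => 0) {1, 2, 3} 1 := by
  have hu := A.u_pos
  have ha := A.a_nonneg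
  refine .of_disjoint_rides hc (.of_lipschitzWith ?_ ?_ ?_) ?_ ?_ ?_
  · refine .of_dist_le_mul fun s t => ?_
    simp only [detour, Real.dist_eq, NNReal.coe_one, one_mul]
    grind
  · simp only [detour]
    grind
  · simp only [detour]
    linarith
  all_goals simp [detour]; grind

theorem le_load_one_of_finish_lt {c : ℕ∞} {rel : Fin A.seq.n → ℝ} {S : Schedule A.seq.n}
    (hS : S.Serves c A.seq rel {1, 2, 3} 1) (hfinish : S.finish < 3 + 2 * A.u) :
    3 + 2 * A.a + A.u ≤ S.load 1 := by
  have h₁ : (1 : Fin A.seq.n) ∈ ({1, 2, 3} : Finset (Fin A.seq.n)) := by simp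
  have h₂ : (2 : Fin A.seq.n) ∈ ({1, 2, 3} : Finset (Fin A.seq.n)) := by simp
  have h₃ : (3 : Fin A.seq.n) ∈ ({1, 2, 3} : Finset (Fin A.seq.n)) := by simp
  have hu := A.u_pos
  have hstart₁ : |-A.u - 1| ≤ S.load 1 := hS.abs_src_sub_le_load h₁
  have hstart₂ : |-A.a - 1| ≤ S.load 2 := hS.abs_src_sub_le_load h₂
  have hstart₃ : |(2 : ℝ) - 1| ≤ S.load 3 := hS.abs_src_sub_le_load h₃
  have hride₂ : S.load 2 + |0 - -A.a| ≤ S.unload 2 := hS.load_add_abs_dst_sub_src_le_unload h₂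
  have h₁₃ := hS.add_abs_pos_sub_le_or (hS.load_nonneg 1 h₁) (hS.load_nonneg 3 h₃)
  have h₁₂ := hS.add_abs_pos_sub_le_or (hS.load_nonneg 1 h₁) (hS.unload_nonneg h₂)
  have h₂₃ := hS.add_abs_pos_sub_le_or (hS.load_nonneg 2 h₂) (hS.load_nonneg 3 h₃)
  simp only [hS.pos_load 1 h₁, hS.pos_load 2 h₂, hS.pos_load 3 h₃, hS.pos_unload 2 h₂,
    Matrix.cons_val] at h₁₃ h₁₂ h₂₃
  have hlast₂ := hS.unload_le_finish 2 h₂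
  have hlast₃ := (hS.load_le_unload 3 h₃).trans (hS.unload_le_finish 3 h₃)
  have hafter₃ : S.load 3 + (2 + A.u) ≤ S.load 1 := by grind
  have hafter₂ : S.unload 2 + A.u ≤ S.load 1 := by grind
  rcases h₂₃ with h₂₃ | h₃₂ <;> grind

theorem finish_eq_of_isShortest {c : ℕ∞} (hc : 1 ≤ c) {S : Schedule A.seq.n}
    (hS : S.IsShortest (Schedule.Serves c A.seq (fun _ => 0) {1, 2, 3} 1)) :
    S.finish = 3 + 2 * A.a + A.u ∧ S.pos S.finish = -A.u := by
  have h₁ : (1 : Fin A.seq.n) ∈ ({1, 2, 3} : Finset (Fin A.seq.n)) := by simp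
  have hle : S.finish ≤ 3 + 2 * A.a + A.u := hS.2 _ (A.detour_serves hc)
  have hload := A.le_load_one_of_finish_lt hS.1 (by linarith [A.two_mul_a_lt_u])
  have hride := hS.1.load_le_unload 1 h₁
  have hlast := hS.1.unload_le_finish 1 h₁
  have hend : S.finish = S.unload 1 := by linarith
  exact ⟨by linarith, hend ▸ hS.1.pos_unload 1 h₁⟩

section Run

variable {c : ℕ∞} (τ : TieBreaking c)

/-- The state in which `Lazy(α)` serves the first request, after `m` arrivals. -/
def carrying (m : ℕ) : State A.seq.n :=
  ⟨m, .followSchedule {0} (τ.sched A.seq {0} 0), A.pickup, 0, ∅, ∅⟩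

/-- The state in which `Lazy(α)` has delivered the first request and waits, after `m` arrivals. -/
def waiting (m : ℕ) : State A.seq.n :=
  ⟨m, .waitUntil A.t₃, A.pickup + 1, 1, ∅, {0}⟩

/-- The time at which `Lazy(α)` sets out to serve the second, third and fourth request. -/
def tourStart : ℝ := max A.t₃ (α * (2 * A.u + 2))

/-- The state in which `Lazy(α)` serves the second, third and fourth request, after `m`
arrivals. -/
def touring (m : ℕ) : State A.seq.n :=
  ⟨m, .followSchedule {1, 2, 3} (τ.sched A.seq {1, 2, 3} 1), A.tourStart, 1, ∅, {0}⟩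

theorem tourStart_lt : A.tourStart < 2 * A.u + 2 :=
  max_lt A.t₃_lt A.alpha_mul_lt_two_mul_u_add_two

theorem sched_zero (hc : 1 ≤ c) :
    (τ.sched A.seq {0} 0).load 0 = 0 ∧ (τ.sched A.seq {0} 0).unload 0 = 1 ∧
      (τ.sched A.seq {0} 0).finish = 1 := by
  obtain ⟨hload, hunload, hfinish⟩ := (τ.sched_shortest A.seq {0} 0).singleton_eq hc
  change (τ.sched A.seq {0} 0).load 0 = max 0 |(0 : ℝ) - 0| at hload
  rw [sub_zero, abs_zero, max_self] at hload
  change (τ.sched A.seq {0} 0).unload 0 = _ + |(1 : ℝ) - 0| at hunload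
  rw [hload, sub_zero, abs_one, zero_add] at hunload
  exact ⟨hload, hunload, hfinish.trans hunload⟩

theorem reaches_carrying (hc : 1 ≤ c) :
    Reaches τ α A.seq (initState A.seq.n) (A.carrying τ 1) := by
  obtain ⟨q, hreach, hq⟩ := exists_reaches_uponIdle_of_rest (τ := τ) (α := α) (0 : Fin A.seq.n) 0 ∅
  have hopt := A.opt_eq_of_lt_u hc le_rfl A.t₀_lt_u
  refine hreach.trans (reaches_followSchedule hq (T := A.pickup) ?_ (Finset.singleton_nonempty 0)
    ?_ ?_ ?_)
  · rfl
  · change max A.t₀ (α * opt c A.seq A.t₀) = A.pickup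
    rw [hopt, pickup]
  · exact (A.opt_eq_of_lt_u hc A.t₀_le_pickup A.pickup_lt_u).trans hopt.symm
  · intro i hi
    obtain rfl : i = 1 := Fin.ext hi.symm
    exact A.pickup_lt_u

theorem step_carrying (hc : 1 ≤ c) {i : Fin A.seq.n} (hu : A.u ≤ A.seq.release i)
    (hi : A.seq.release i < A.pickup + 1) :
    step τ α A.seq (A.carrying τ i) = A.carrying τ (i + 1) := by
  obtain ⟨hload, hunload, hfinish⟩ := A.sched_zero τ hc
  have hpickup := A.pickup_lt_u
  have hloaded : 0 ∈ (A.carrying τ i).loadedAt (A.seq.release i) := by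
    refine Finset.mem_filter.2 ⟨Finset.mem_singleton_self 0, ?_, ?_⟩ <;>
      simp only [carrying, hload, hunload] <;> linarith
  refine step_of_continue rfl (by simp [carrying]) ?_ ?_
  · refine WithTop.coe_le_coe.2 ?_
    change A.seq.release i ≤ A.pickup + (τ.sched A.seq {0} 0).finish
    rw [hfinish]
    exact hi.le
  rw [A.opt_eq_of_u_le hc hu (by linarith [A.pickup_add_one_le_t₃])]
  have hpos : (A.carrying τ i).posAt (A.seq.release i) ≤ A.seq.release i - A.pickup := by
    have := (τ.sched_shortest A.seq {0} 0).1.abs_pos_sub_start_le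
      (t := A.seq.release i - A.pickup) (by linarith)
    rw [sub_zero] at this
    exact (le_abs_self _).trans this
  have hback := (τ.back_shortest A.seq ((A.carrying τ i).loadedAt (A.seq.release i))
    ((A.carrying τ i).posAt (A.seq.release i))).1.abs_dst_sub_add_abs_dst_le_finish hloaded
  change |1 - (A.carrying τ i).posAt (A.seq.release i)| + |1| ≤ _ at hback
  have := A.alpha_le_pickup
  have := A.u_le_one
  have := A.alpha_lt_one
  have hα : α * A.u ≤ α := mul_le_of_le_one_right A.alpha_nonneg A.u_le_one
  rw [abs_one] at hback
  linarith [le_abs_self (1 - (A.carrying τ i).posAt (A.seq.release i))]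

theorem carrying_isEmptyAt (hc : 1 ≤ c) (m : ℕ) :
    (A.carrying τ m).IsEmptyAt (A.pickup + 1) m 1 {0} := by
  obtain ⟨-, hunload, hfinish⟩ := A.sched_zero τ hc
  have hserves := (τ.sched_shortest A.seq {0} 0).1
  have hpos : (τ.sched A.seq {0} 0).pos 1 = 1 := by
    simpa [hunload] using hserves.pos_unload 0 (Finset.mem_singleton_self 0)
  have hempty := State.isEmptyAt_of_followSchedule (q := A.carrying τ m) rfl hserves
  simpa [carrying, hfinish, hpos] using hempty

theorem step_of_empty_t₃ (hc : 1 ≤ c) {q : State A.seq.n} {V : Finset (Fin A.seq.n)}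
    (hq : q.IsEmptyAt A.t₃ 3 1 V) (hcmd : q.cmd ≠ .rest) (hend : q.endTime = A.t₃) :
    step τ α A.seq q = { q with arrived := 4 } := by
  have h := step_of_continue (τ := τ) (α := α) (i := (3 : Fin A.seq.n)) hq.arrived hcmd hend.ge ?_
  · rwa [hq.arrived] at h
  have hback := (τ.back_shortest A.seq ∅ 1).1.abs_start_le_finish
  change α * opt c A.seq A.t₃ < A.t₃ + (τ.back A.seq (q.loadedAt A.t₃) (q.posAt A.t₃)).finish
  rw [A.opt_eq_of_t₃_le hc le_rfl, hq.loadedAt, hq.posAt]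
  rw [abs_one] at hback
  have : α * (2 * A.u + 1) ≤ A.t₃ := le_max_right _ _
  linarith [A.alpha_lt_one]

theorem exists_reaches_uponIdle_t₃ (hc : 1 ≤ c) :
    ∃ q, Reaches τ α A.seq (A.carrying τ 3) (uponIdle τ α A.seq A.t₃ q) ∧
      q.IsEmptyAt A.t₃ 4 1 {0} := by
  have hlater : ∀ i : Fin A.seq.n, 4 = (i : ℕ) → A.t₃ < A.seq.release i := by
    intro i hi
    obtain rfl : i = 4 := Fin.ext hi.symm
    exact A.t₃_lt
  have hend : (A.carrying τ 3).endTime = (A.pickup + 1 : ℝ) :=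
    congrArg (fun x : ℝ => ((A.pickup + x : ℝ) : WithTop ℝ)) (A.sched_zero τ hc).2.2
  rcases A.pickup_add_one_le_t₃.eq_or_lt with heq | hlt
  · have hempty := A.carrying_isEmptyAt τ hc
    rw [heq] at hempty hend
    refine ⟨A.carrying τ 4, ?_, hempty 4⟩
    refine .tail (.single (A.step_of_empty_t₃ τ hc (hempty 3) nofun hend)) ?_
    exact step_of_idle hend hlater
  · have hopt : opt c A.seq (A.pickup + 1) = 2 * A.u + 1 :=
      A.opt_eq_of_u_le hc (by linarith [A.u_le_one, A.t₀_pos, A.t₀_le_pickup]) hlt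
    have ht₃ : α * opt c A.seq (A.pickup + 1) = A.t₃ := by
      rw [hopt, t₃, max_eq_right]
      exact (lt_max_iff.1 hlt).elim (absurd · (lt_irrefl _)) le_of_lt
    have hwait : step τ α A.seq (A.carrying τ 3) = A.waiting 3 := by
      rw [step_of_idle hend, uponIdle_eq_waitUntil (A.carrying_isEmptyAt τ hc 3), ht₃, waiting]
      · rwa [ht₃]
      · intro i hi
        obtain rfl : i = 3 := Fin.ext hi.symm
        exact hlt
    refine ⟨A.waiting 4, ?_, ⟨rfl, rfl, rfl, rfl⟩⟩
    refine .tail (.tail (.single hwait)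
      (A.step_of_empty_t₃ τ hc ⟨rfl, rfl, rfl, rfl⟩ nofun rfl)) ?_
    exact step_of_idle rfl hlater

theorem reaches_touring (hc : 1 ≤ c) :
    Reaches τ α A.seq (initState A.seq.n) (A.touring τ 4) := by
  have hu := A.two_mul_u_sub_a_lt_pickup_add_one
  have hau := A.two_mul_a_lt_u
  have ha := A.a_nonneg
  have ht₀ := A.t₀_pos.trans_le A.t₀_le_pickup
  have h₂ : step τ α A.seq (A.carrying τ 1) = A.carrying τ 2 :=
    A.step_carrying τ hc (i := 1) le_rfl (A.u_le_one.trans_lt (by linarith))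
  have h₃ : step τ α A.seq (A.carrying τ 2) = A.carrying τ 3 :=
    A.step_carrying τ hc (i := 2) (show A.u ≤ 2 * A.u - A.a by linarith) hu
  obtain ⟨q, hidle, hq⟩ := A.exists_reaches_uponIdle_t₃ τ hc
  have htour : Reaches τ α A.seq (uponIdle τ α A.seq A.t₃ q) (A.touring τ 4) := by
    have hopt := A.opt_eq_of_t₃_le hc le_rfl
    refine reaches_followSchedule hq rfl (Finset.insert_nonempty _ _) ?_ ?_ ?_
    · rw [hopt, tourStart]
    · exact (A.opt_eq_of_t₃_le hc (le_max_left _ _)).trans hopt.symm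
    · intro i hi
      obtain rfl : i = 4 := Fin.ext hi.symm
      exact A.tourStart_lt
  exact (((A.reaches_carrying τ hc).tail h₂).tail h₃).trans (hidle.trans htour)

/-- The time at which `Lazy(α)` has served all requests but the last one. -/
def tourEnd : ℝ := A.tourStart + (3 + 2 * A.a + A.u)

/-- The state in which `Lazy(α)` serves the last request. -/
def finale : State A.seq.n :=
  ⟨5, .followSchedule {4} (τ.sched A.seq {4} (-A.u)), A.tourEnd, -A.u, ∅, {0} ∪ {1, 2, 3}⟩

theorem touring_endTime (hc : 1 ≤ c) (m : ℕ) : (A.touring τ m).endTime = A.tourEnd :=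
  congrArg (fun x : ℝ => ((A.tourStart + x : ℝ) : WithTop ℝ))
    (A.finish_eq_of_isShortest hc (τ.sched_shortest A.seq {1, 2, 3} 1)).1

theorem two_mul_u_add_two_le_tourEnd : 2 * A.u + 2 ≤ A.tourEnd := by
  have : A.pickup + 1 ≤ A.tourStart := A.pickup_add_one_le_t₃.trans (le_max_left _ _)
  rw [tourEnd]
  linarith [A.u_le_one, A.t₀_pos, A.t₀_le_pickup, A.a_nonneg]

theorem touring_isEmptyAt (hc : 1 ≤ c) (m : ℕ) :
    (A.touring τ m).IsEmptyAt A.tourEnd m (-A.u) ({0} ∪ {1, 2, 3}) := by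
  have hshortest := τ.sched_shortest A.seq {1, 2, 3} 1
  obtain ⟨hfinish, hpos⟩ := A.finish_eq_of_isShortest hc hshortest
  have hempty := State.isEmptyAt_of_followSchedule (q := A.touring τ m) rfl hshortest.1
  rw [hpos, hfinish] at hempty
  exact hempty

theorem step_touring_four (hc : 1 ≤ c) : step τ α A.seq (A.touring τ 4) = A.touring τ 5 := by
  refine step_of_continue (i := (4 : Fin A.seq.n)) rfl nofun ?_ ?_
  · rw [A.touring_endTime τ hc]
    exact WithTop.coe_le_coe.2 A.two_mul_u_add_two_le_tourEnd
  · rw [A.opt_eq_of_t₃_le (t := A.seq.release 4) hc A.t₃_lt.le]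
    exact A.alpha_mul_lt_two_mul_u_add_two.trans_le
      (le_add_of_nonneg_right (τ.back_shortest A.seq _ _).1.finish_nonneg)

theorem step_touring_five (hc : 1 ≤ c) : step τ α A.seq (A.touring τ 5) = A.finale τ := by
  rw [step_of_idle (A.touring_endTime τ hc 5) fun i hi => absurd i.2 (hi ▸ lt_irrefl 5)]
  refine uponIdle_eq_followSchedule (A.touring_isEmptyAt τ hc 5) ?_ rfl
    (Finset.singleton_nonempty 4)
  have hlate := A.two_mul_u_add_two_le_tourEnd
  rw [A.opt_eq_of_t₃_le hc (A.t₃_lt.le.trans hlate)]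
  exact A.alpha_mul_lt_two_mul_u_add_two.le.trans hlate

theorem servedAt_touring_ne_univ (m : ℕ) (T : ℝ) :
    (A.touring τ m).servedAt T ≠ Finset.univ := by
  intro h
  have h₄ : (4 : Fin A.seq.n) ∈ (A.touring τ m).servedAt T := h ▸ Finset.mem_univ _
  change 4 ∈ ({0} : Finset (Fin 5)) ∪ Finset.filter _ {1, 2, 3} at h₄
  simp at h₄

theorem two_add_u_le_unload_four : 2 + A.u ≤ (τ.sched A.seq {4} (-A.u)).unload 4 := by
  have hserves := (τ.sched_shortest A.seq {4} (-A.u)).1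
  have hload : |2 - -A.u| ≤ (τ.sched A.seq {4} (-A.u)).load 4 :=
    hserves.abs_src_sub_le_load (Finset.mem_singleton_self 4)
  have hride := hserves.load_le_unload 4 (Finset.mem_singleton_self 4)
  linarith [le_abs_self (2 - -A.u)]

theorem le_endTime_finale : (A.tourEnd + (2 + A.u) : ℝ) ≤ (A.finale τ).endTime := by
  refine WithTop.coe_le_coe.2 (add_le_add_right ?_ A.tourEnd)
  exact (A.two_add_u_le_unload_four τ).trans
    ((τ.sched_shortest A.seq {4} (-A.u)).1.unload_le_finish 4 (Finset.mem_singleton_self 4))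

theorem le_of_servedAt_finale {T : ℝ} (hT : (A.finale τ).servedAt T = Finset.univ) :
    A.tourEnd + (2 + A.u) ≤ T := by
  have h₄ : (4 : Fin A.seq.n) ∈ (A.finale τ).servedAt T := hT ▸ Finset.mem_univ _
  have hunload : A.tourEnd + (τ.sched A.seq {4} (-A.u)).unload 4 ≤ T := by
    simpa [State.servedAt, finale] using h₄
  linarith [A.two_add_u_le_unload_four τ]

theorem le_of_completedBy (hc : 1 ≤ c) {T : ℝ} (hT : CompletedBy τ α A.seq T) :
    A.tourEnd + (2 + A.u) ≤ T := by
  have htouring := hT.completedFrom.of_reaches (A.reaches_touring τ hc) (by decide : 4 < 5)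
  have hfinale := completedFrom_step
    (A.step_touring_four τ hc ▸ completedFrom_step htouring (A.servedAt_touring_ne_univ τ 4 T))
    (A.servedAt_touring_ne_univ τ 5 T)
  rw [A.step_touring_five τ hc] at hfinale
  exact hfinale.le le_rfl (A.le_endTime_finale τ) fun _ => A.le_of_servedAt_finale τ

theorem ofReal_le_competitiveRatio (hc : 1 ≤ c) :
    ENNReal.ofReal (α + (5 + 2 * A.a + 2 * A.u) / (2 * A.u + 2)) ≤ competitiveRatio τ α := by
  have hopt : optOf c A.seq Finset.univ = 2 * A.u + 2 :=
    A.optOf_eq_of_mem hc (Finset.mem_univ _) (Finset.mem_univ _)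
  have hpos : 0 < 2 * A.u + 2 := by linarith [A.u_pos]
  have hratio := ofReal_div_optOf_le_competitiveRatio (by decide : 0 < 5) (hopt ▸ hpos)
    fun T hT => A.le_of_completedBy τ hc hT
  rw [hopt] at hratio
  refine (ENNReal.ofReal_le_ofReal ?_).trans hratio
  rw [le_div_iff₀ hpos, add_mul, div_mul_cancel₀ _ hpos.ne', tourEnd]
  have : α * (2 * A.u + 2) ≤ A.tourStart := le_max_right _ _
  linarith

end Run

end Adversary

theorem ofReal_add_div_le_competitiveRatio {c : ℕ∞} (hc : 1 ≤ c) {α u : ℝ} (hα₀ : 0 ≤ α)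
    (hu : α < u) (hu₁ : 2 * u < 1 + α) (τ : TieBreaking c) :
    ENNReal.ofReal (α + (5 + α + 2 * u) / (2 * u + 2)) ≤ competitiveRatio τ α := by
  let A : Adversary α :=
    { t₀ := (u - α) / 2
      u := u
      a := α / 2
      alpha_nonneg := hα₀
      alpha_lt_one := by linarith
      t₀_pos := by linarith
      t₀_lt_u := by linarith
      alpha_mul_lt_u := by nlinarith
      u_le_one := by linarith
      a_nonneg := by linarith
      two_mul_a_lt_u := by linarith
      two_mul_u_sub_a_lt := by linarith }
  have hratio := A.ofReal_le_competitiveRatio τ hc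
  rwa [show 2 * A.a = α from mul_div_cancel₀ α two_ne_zero] at hratio

end DialARide

theorem proposition3_general (c : ℕ∞) (hc : 1 ≤ c) (τ : DialARide.TieBreaking c)
    (α : ℝ) (hα : α ∈ Set.Ico (0 : ℝ) 1) :
    ENNReal.ofReal (2 + α + (1 - α) / (2 + 2 * α)) ≤ DialARide.competitiveRatio τ α := by
  obtain ⟨hα₀, hα₁⟩ := hα
  have hcont : ContinuousAt (fun u : ℝ => α + (5 + α + 2 * u) / (2 * u + 2)) α := by
    fun_prop (disch := positivity)
  have hlim := (ENNReal.continuous_ofReal.tendsto _).comp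
    (hcont.tendsto.mono_left nhdsWithin_le_nhds : Tendsto _ (𝓝[>] α) _)
  have hvalue : α + (5 + α + 2 * α) / (2 * α + 2) = 2 + α + (1 - α) / (2 + 2 * α) := by
    field_simp
    ring
  rw [hvalue] at hlim
  refine le_of_tendsto hlim ?_
  filter_upwards [Ioo_mem_nhdsGT (show α < (1 + α) / 2 by linarith)] with u hu
  exact DialARide.ofReal_add_div_le_competitiveRatio hc hα₀ hu.1 (by linarith [hu.2]) τ

theorem proposition3 (c : ℕ∞) (hc : 1 ≤ c) (τ : DialARide.TieBreaking c)
    (α : ℝ) (hα : α ∈ Set.Ico (0 : ℝ) 1) :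
    ENNReal.ofReal (2 + α + (1 - α) / (2 + 3 * α)) ≤ DialARide.competitiveRatio τ α := by
  refine (ENNReal.ofReal_le_ofReal ?_).trans (proposition3_general c hc τ α hα)
  gcongr <;> linarith [hα.1, hα.2]
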